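/- Let $\mathbb{R}^3_1$ be $\mathbb{R}^3$ with the Lorentz inner product $\langle X,Y\rangle=x_1y_1+x_2y_2-x_3y_3$. Let $\gamma$ be a closed curve of class $C^2$ in $\mathbb{R}^3_1$, i.e. a $C^2$ map $\gamma:\mathbb{R}\to\mathbb{R}^3_1$ with $\gamma(t+P)=\gamma(t)$ for some $P>0$. Suppose that $\gamma$ is strong spacelike: $\langle\gamma',\gamma'\rangle>0$ everywhere and, with $s$ the arc length, the unit tangent vector $T=d\gamma/ds$ and the curvature vector $dT/ds=\kappa N$ span at each point a 2-plane on which $\langle\cdot,\cdot\rangle$ is positive definite. Suppose also that $\gamma$ has index $1$: over one period, the loop $T$ winds exactly once (in one of the two directions) around the de Sitter sphere $\mathbb{S}^2_1=\{X:\langle X,X\rangle=1\}$, which is homotopy equivalent to a circle; that is, a continuous choice of the longitude (the polar angle of $(x_1,x_2)$) of $T$ changes by $\pm 2\pi$ over one period. Then, with $\kappa=\sqrt{\langle dT/ds,dT/ds\rangle}$, the total curvature over one period satisfies $$\int_\gamma \kappa\,ds\le 2\pi ,$$ and equality holds if and only if $\gamma$ is a convex curve in an affine plane $E$ on whose direction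 $\langle\cdot,\cdot\rangle$ is positive definite, i.e. $\gamma$ is a simple closed curve contained in $E$ that lies on one side of each of its tangent lines in $E$. -/

import Mathlib

open scoped Real

noncomputable section

namespace Minkowski3

/-- The underlying vector space of the 3-dimensional Minkowski space. -/
abbrev Space : Type := Fin 3 → ℝ

/-- The Lorentz inner product `x₁y₁ + x₂y₂ - x₃y₃`. -/
def lorentz (X Y : Space) : ℝ := X 0 * Y 0 + X 1 * Y 1 - X 2 * Y 2

/-- A 2-dimensional linear subspace on which the Lorentz product is positive definite. -/
def IsSpacelikePlane (W : Submodule ℝ Space) : Prop :=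
  Module.finrank ℝ W = 2 ∧ ∀ X ∈ W, X ≠ 0 → 0 < lorentz X X

/-- The de Sitter sphere, i.e. the one-sheeted hyperboloid of unit spacelike vectors. -/
def deSitter : Set Space := {X | lorentz X X = 1}

/-- A (parametrized) curve is spacelike if all its velocity vectors are. In particular such a
curve is regular. -/
def IsSpacelikeCurve (γ : ℝ → Space) : Prop :=
  ∀ t, 0 < lorentz (deriv γ t) (deriv γ t)

/-- The speed `ds/dt` of a spacelike curve. -/
def speed (γ : ℝ → Space) (t : ℝ) : ℝ := √(lorentz (deriv γ t) (deriv γ t))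

/-- The unit tangent vector `T = dγ/ds` of a spacelike curve. -/
def unitTangent (γ : ℝ → Space) (t : ℝ) : Space := (speed γ t)⁻¹ • deriv γ t

/-- The curvature vector `κN = dT/ds` of a spacelike curve, the second derivative of the curve
with respect to arc length. -/
def curvatureVector (γ : ℝ → Space) (t : ℝ) : Space :=
  (speed γ t)⁻¹ • deriv (unitTangent γ) t

/-- The curvature `κ = √⟨dT/ds, dT/ds⟩` (for curves whose curvature vector is spacelike). -/
def curvature (γ : ℝ → Space) (t : ℝ) : ℝ :=
  √(lorentz (curvatureVector γ t) (curvatureVector γ t))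

/-- The total curvature `∫ κ ds` over one period `[0, P]`, where `ds = speed dt`. -/
def totalCurvature (γ : ℝ → Space) (P : ℝ) : ℝ :=
  ∫ t in (0 : ℝ)..P, curvature γ t * speed γ t

/-- Strong spacelike curves: the unit tangent vector and the curvature vector span a spacelike
2-plane at each point. -/
def IsStrongSpacelike (γ : ℝ → Space) : Prop :=
  IsSpacelikeCurve γ ∧
    ∀ t, IsSpacelikePlane (Submodule.span ℝ {unitTangent γ t, curvatureVector γ t})

/-- The `P`-periodic loop `c` in the de Sitter sphere winds `n` times around it: the longitude
along `c` has a continuous determination `θ` that increases by `2πn` over a period.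
(The longitude `(x₁, x₂) / |(x₁, x₂)|` is a homotopy equivalence from the de Sitter sphere to
the circle, so that `n` is the class of the loop in the fundamental group `ℤ`.) -/
def HasWinding (c : ℝ → Space) (P : ℝ) (n : ℤ) : Prop :=
  (∀ t, c t ∈ deSitter) ∧
    ∃ θ : ℝ → ℝ, Continuous θ ∧
      (∀ t, c t 0 = √(c t 0 ^ 2 + c t 1 ^ 2) * Real.cos (θ t) ∧
        c t 1 = √(c t 0 ^ 2 + c t 1 ^ 2) * Real.sin (θ t)) ∧
      ∀ t, θ (t + P) = θ t + 2 * π * n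

/-- The closed spacelike curve `γ` of period `P` has index `n`: its tangent indicatrix winds `n`
times around the de Sitter sphere, for one of the two orientations of the latter (the index is
normalized to be nonnegative). -/
def HasIndex (γ : ℝ → Space) (P : ℝ) (n : ℕ) : Prop :=
  HasWinding (unitTangent γ) P n ∨ HasWinding (unitTangent γ) P (-n)

/-- The closed regular curve `γ` of period `P` is a convex curve in the affine plane `E`: it is a
simple closed curve in `E` and lies on one side of each of its tangent lines in `E`. -/
def IsConvexCurveIn (E : AffineSubspace ℝ Space) (γ : ℝ → Space) (P : ℝ) : Prop :=
  (∀ t, γ t ∈ E) ∧ Set.InjOn γ (Set.Ico 0 P) ∧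
    ∀ t, ∃ f : Space →ₗ[ℝ] ℝ, (∃ w ∈ E.direction, f w ≠ 0) ∧ f (deriv γ t) = 0 ∧
      ∀ u, 0 ≤ f (γ u - γ t)

end Minkowski3

end

/-!
Write `T` for the unit tangent of the curve `γ`. It is a closed spacelike curve on the de Sitter
sphere, and its length is the total curvature of `γ`. The proof is the Lorentzian counterpart of
the classical proof of Fenchel's theorem, in which the inequalities of spherical geometry are
reversed.

In the coordinates longitude and `arctan x₃` the metric of the de Sitter sphere is conformal to
a flat Lorentz metric on the cylinder. Since `T` winds around the sphere just once, all its chords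
are spacelike, i.e. `⟨T a, T b⟩ < 1` for distinct points (`lorentz_lt_one_of_hasWinding`). As the
Gram determinant of three vectors is nonpositive, `u = ⟨T a, T⟩` satisfies `u'² ≥ 1 - u²` with
respect to arc length. So as long as `|u| < 1`, the function `arccos u` changes at least at unit
rate. It follows that on a loop of length at least `2π` a point at arc length `x ≤ L / 2` from
`T a` satisfies `⟨T a, T⟩ ≤ cos (min x π)` (`IsAchronalLoop.lorentz_le_cos`).

Let `T a` and `T b` halve a loop of length `L ≥ 2π`. The comparison from both of these points gives
`⟨T a + T b, T⟩ ≤ 0` along the loop. The integral of this function along `γ` vanishes, because `γ`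
is closed, and hence so does the function. If `L > 2π`, it is negative somewhere, a contradiction
(`IsAchronalLoop.length_le_two_pi`). If `L = 2π`, then `T a + T b` is orthogonal to itself and lies in
the spacelike plane spanned by `T a` and `T' a`, so it is zero; comparing from both endpoints then yields
`⟨T a, T t⟩ = cos (S t - S a)` for the arc length `S`. So `T` runs once through a great circle, and
`γ` is a plane curve whose height over each of its tangent lines has derivative proportional to
the sine of the tangent angle, which makes it convex (`IsAchronalLoop.exists_isConvexCurveIn`).

Conversely, in a spacelike plane the inequality `u'² ≤ 1 - u²` holds as well, so that `T` needs the
length `π` to reach the antipode of its starting point and again to return from there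
(`IsAchronalLoop.two_pi_le_length`).
-/

open scoped Real

namespace Minkowski3

/-! ### Linear algebra of the Lorentz product -/

/-- The Lorentz product with a fixed vector, as a linear functional. -/
noncomputable def lorentzForm (X : Space) : Space →ₗ[ℝ] ℝ where
  toFun Y := lorentz X Y
  map_add' Y Z := by simp only [lorentz, Pi.add_apply]; ring
  map_smul' c Y := by simp only [lorentz, Pi.smul_apply, smul_eq_mul, RingHom.id_apply]; ring

@[simp] lemma lorentzForm_apply (X Y : Space) : lorentzForm X Y = lorentz X Y := rfl

lemma lorentz_comm (X Y : Space) : lorentz X Y = lorentz Y X := by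
  simp only [lorentz]; ring

lemma lorentz_add_left (X Y Z : Space) : lorentz (X + Y) Z = lorentz X Z + lorentz Y Z := by
  simp only [lorentz, Pi.add_apply]; ring

lemma lorentz_smul_left (c : ℝ) (X Y : Space) : lorentz (c • X) Y = c * lorentz X Y := by
  simp only [lorentz, Pi.smul_apply, smul_eq_mul]; ring

lemma lorentz_smul_right (c : ℝ) (X Y : Space) : lorentz X (c • Y) = c * lorentz X Y := by
  simp only [lorentz, Pi.smul_apply, smul_eq_mul]; ring

/-- The Lorentz cross product: `lorentz (lorentzCross Y Z) X` is the determinant of `X, Y, Z`. -/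
noncomputable def lorentzCross (Y Z : Space) : Space :=
  ![Y 1 * Z 2 - Y 2 * Z 1, Y 2 * Z 0 - Y 0 * Z 2, -(Y 0 * Z 1 - Y 1 * Z 0)]

lemma lorentz_lorentzCross (X Y Z : Space) :
    lorentz (lorentzCross Y Z) X =
      (Y 1 * Z 2 - Y 2 * Z 1) * X 0 + (Y 2 * Z 0 - Y 0 * Z 2) * X 1
        + (Y 0 * Z 1 - Y 1 * Z 0) * X 2 := by
  simp only [lorentz, lorentzCross, Matrix.cons_val]
  ring

/-- The Gram determinant of three vectors is minus the square of their determinant, here for a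
unit vector `Y` and a vector `Z` orthogonal to it. -/
lemma gram_eq_neg_sq {X Y Z : Space} (hY : lorentz Y Y = 1) (hYZ : lorentz Y Z = 0) :
    (lorentz X X - lorentz X Y ^ 2) * lorentz Z Z - lorentz X Z ^ 2
      = -lorentz (lorentzCross Y Z) X ^ 2 := by
  have key : lorentz X X * (lorentz Y Y * lorentz Z Z - lorentz Y Z ^ 2)
      - lorentz X Y * (lorentz X Y * lorentz Z Z - lorentz Y Z * lorentz X Z)
      + lorentz X Z * (lorentz X Y * lorentz Y Z - lorentz Y Y * lorentz X Z)
      = -lorentz (lorentzCross Y Z) X ^ 2 := by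
    rw [lorentz_lorentzCross]; simp only [lorentz]; ring
  rw [hY, hYZ] at key
  linarith

/-- A plane spanned by a unit vector and an orthogonal vector is the kernel of the functional
given by their cross product. -/
lemma span_eq_ker_lorentzForm {Y Z : Space} (hY : lorentz Y Y = 1) (hYZ : lorentz Y Z = 0)
    (hZ : 0 < lorentz Z Z) (h : Module.finrank ℝ (Submodule.span ℝ {Y, Z}) = 2) :
    Submodule.span ℝ {Y, Z} = LinearMap.ker (lorentzForm (lorentzCross Y Z)) := by
  have hle : Submodule.span ℝ {Y, Z} ≤ LinearMap.ker (lorentzForm (lorentzCross Y Z)) := by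
    rw [Submodule.span_le]
    rintro X (rfl | rfl)
    · simp only [SetLike.mem_coe, LinearMap.mem_ker, lorentzForm_apply, lorentz_lorentzCross]
      ring
    · simp only [SetLike.mem_coe, LinearMap.mem_ker, lorentzForm_apply, lorentz_lorentzCross]
      ring
  refine Submodule.eq_of_le_of_finrank_le hle ?_
  -- The functional does not vanish on the timelike vector `(0, 0, 1)`.
  have hne : lorentzForm (lorentzCross Y Z) ≠ 0 := by
    intro h0
    have h1 := gram_eq_neg_sq (X := ![0, 0, 1]) hY hYZ
    have h2 : lorentz (lorentzCross Y Z) ![0, 0, 1] = 0 := by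
      rw [← lorentzForm_apply, h0, LinearMap.zero_apply]
    rw [h2] at h1
    simp only [lorentz, Matrix.cons_val] at h1 hZ
    nlinarith [mul_nonneg (sq_nonneg (Y 2)) hZ.le, sq_nonneg (Z 2)]
  have := Module.Dual.finrank_ker_add_one_of_ne_zero hne
  rw [Module.finrank_fin_fun] at this
  omega

lemma hasDerivAt_lorentz {f g : ℝ → Space} {f' g' : Space} {t : ℝ} (hf : HasDerivAt f f' t)
    (hg : HasDerivAt g g' t) :
    HasDerivAt (fun t => lorentz (f t) (g t))
      (lorentz f' (g t) + lorentz (f t) g') t := by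
  have hf := hasDerivAt_pi.1 hf
  have hg := hasDerivAt_pi.1 hg
  have := (((hf 0).mul (hg 0)).add ((hf 1).mul (hg 1))).sub ((hf 2).mul (hg 2))
  refine this.congr_deriv ?_
  simp only [lorentz]; ring

lemma hasDerivAt_lorentz_const {g : ℝ → Space} {g' : Space} {t : ℝ} (X : Space)
    (hg : HasDerivAt g g' t) :
    HasDerivAt (fun t => lorentz X (g t)) (lorentz X g') t := by
  have := hasDerivAt_lorentz (hasDerivAt_const t X) hg
  simpa [lorentz] using this

/-! ### Conformal coordinates on the de Sitter sphere -/

/-- A continuous polar angle of a plane curve with differentiable coordinates is differentiable. -/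
lemma hasDerivAt_polarAngle {x y r θ : ℝ → ℝ} {x' y' t₀ : ℝ} (hθ : Continuous θ)
    (hr : ∀ t, 0 < r t) (hrd : DifferentiableAt ℝ r t₀)
    (hx : ∀ t, x t = r t * Real.cos (θ t)) (hy : ∀ t, y t = r t * Real.sin (θ t))
    (hx' : HasDerivAt x x' t₀) (hy' : HasDerivAt y y' t₀) :
    HasDerivAt θ ((x t₀ * y' - y t₀ * x') / r t₀ ^ 2) t₀ := by
  -- Near `t₀` the angle is `θ t₀` plus the arcsine of the sine of the difference, and that sine
  -- is an algebraic expression in the coordinates.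
  have hev : θ =ᶠ[nhds t₀] fun t =>
      θ t₀ + Real.arcsin ((x t₀ * y t - y t₀ * x t) / (r t₀ * r t)) := by
    have hc : Filter.Tendsto (fun t => θ t - θ t₀) (nhds t₀) (nhds 0) := by
      have : Continuous fun t => θ t - θ t₀ := by fun_prop
      simpa using this.tendsto t₀
    have hpi : (0 : ℝ) < π / 2 := by positivity
    filter_upwards [hc (Ioo_mem_nhds (neg_lt_zero.2 hpi) hpi)] with t ht
    have hs : (x t₀ * y t - y t₀ * x t) / (r t₀ * r t) = Real.sin (θ t - θ t₀) := by
      have h1 := (hr t₀).ne'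
      have h2 := (hr t).ne'
      rw [hx, hy, hx, hy, Real.sin_sub]
      field_simp
    rw [hs, Real.arcsin_sin ht.1.le ht.2.le]
    ring
  have h1 := (hr t₀).ne'
  have hq := (((hy'.const_mul (x t₀)).sub (hx'.const_mul (y t₀))).div
    (hrd.hasDerivAt.const_mul (r t₀)) (mul_ne_zero h1 h1))
  have hz : (x t₀ * y t₀ - y t₀ * x t₀) / (r t₀ * r t₀) = 0 := by
    rw [mul_comm, sub_self, zero_div]
  have ha := (Real.hasDerivAt_arcsin (x := (x t₀ * y t₀ - y t₀ * x t₀) / (r t₀ * r t₀))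
    (by rw [hz]; norm_num) (by rw [hz]; norm_num)).comp t₀ hq
  have hfin := (ha.const_add (θ t₀)).congr_of_eventuallyEq hev
  refine hfin.congr_deriv ?_
  simp only [hz]
  simp only [Pi.sub_apply, mul_comm (y t₀) (x t₀), sub_self, zero_mul, sub_zero]
  simp
  field_simp

/-- Chords of a once winding closed spacelike curve on the de Sitter sphere are spacelike. In the
coordinates longitude `η` and `τ = arctan x₃` the metric of the de Sitter sphere is conformal to
`dη² - dτ²`, so that the curve has slope less than `1`, and
`⟨X, Y⟩ - 1` is a positive multiple of `cos Δη - cos Δτ`. -/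
lemma lorentz_lt_one_of_hasWinding {T T' : ℝ → Space} {P : ℝ} {n : ℤ} (hP : 0 < P)
    (hT : ∀ t, HasDerivAt T (T' t) t) (hpos : ∀ t, 0 < lorentz (T' t) (T' t))
    (hper : Function.Periodic T P) (hw : HasWinding T P n) (hn : n = 1 ∨ n = -1)
    {a b : ℝ} (hab : a < b) (hbP : b < a + P) : lorentz (T a) (T b) < 1 := by
  obtain ⟨hdS, θ, hθ, hcs, hθP⟩ := hw
  have hdS : ∀ t, lorentz (T t) (T t) = 1 := hdS
  have hn2 : (n : ℝ) * n = 1 := by rcases hn with rfl | rfl <;> norm_num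
  set r : ℝ → ℝ := fun t => √(T t 0 ^ 2 + T t 1 ^ 2) with hr
  have hr2 : ∀ t, T t 0 ^ 2 + T t 1 ^ 2 = 1 + T t 2 ^ 2 := fun t => by
    have := hdS t; simp only [lorentz] at this; linarith
  have hrpos : ∀ t, 0 < r t := fun t => Real.sqrt_pos.2 (by rw [hr2]; positivity)
  have hrsq : ∀ t, r t ^ 2 = 1 + T t 2 ^ 2 := fun t => by
    rw [hr, Real.sq_sqrt (by positivity), hr2]
  have hd : ∀ i t, HasDerivAt (fun s => T s i) (T' t i) t := fun i t => hasDerivAt_pi.1 (hT t) i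
  have hrd : ∀ t, DifferentiableAt ℝ r t := fun t => by
    refine DifferentiableAt.sqrt ?_ (by rw [hr2]; positivity)
    exact (((hd 0 t).differentiableAt.pow 2).add ((hd 1 t).differentiableAt.pow 2))
  have hθd : ∀ t, HasDerivAt θ ((T t 0 * T' t 1 - T t 1 * T' t 0) / r t ^ 2) t := fun t =>
    hasDerivAt_polarAngle hθ hrpos (hrd t) (fun t => (hcs t).1) (fun t => (hcs t).2)
      (hd 0 t) (hd 1 t)
  set τ : ℝ → ℝ := fun t => Real.arctan (T t 2) with hτ
  have hτd : ∀ t, HasDerivAt τ (T' t 2 / r t ^ 2) t := fun t => by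
    refine (hd 2 t).arctan.congr_deriv ?_
    rw [hrsq]; ring
  -- The curve is spacelike for the conformal metric `dη² - dτ²`.
  have hslope : ∀ t, |T' t 2| < |T t 0 * T' t 1 - T t 1 * T' t 0| := fun t => by
    have h1 : T t 0 * T' t 0 + T t 1 * T' t 1 - T t 2 * T' t 2 = 0 := by
      have h2 := hasDerivAt_lorentz (hT t) (hT t)
      have h3 : HasDerivAt (fun s => lorentz (T s) (T s)) 0 t := by
        simp only [hdS]; exact hasDerivAt_const t 1
      have h4 := h2.unique h3
      simp only [lorentz] at h4
      linarith
    have h5 := hpos t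
    have h6 := hr2 t
    simp only [lorentz] at h5
    rw [← sq_lt_sq]
    have h7 : (T t 0 * T' t 1 - T t 1 * T' t 0) ^ 2
        = (T t 0 ^ 2 + T t 1 ^ 2) * (T' t 0 ^ 2 + T' t 1 ^ 2)
          - (T t 0 * T' t 0 + T t 1 * T' t 1) ^ 2 := by ring
    rw [h7, show T t 0 * T' t 0 + T t 1 * T' t 1 = T t 2 * T' t 2 by linarith, h6]
    nlinarith [mul_nonneg (sq_nonneg (T t 2)) h5.le]
  have hθne : ∀ t ∈ (Set.univ : Set ℝ),
      (T t 0 * T' t 1 - T t 1 * T' t 0) / r t ^ 2 ≠ 0 := fun t _ => by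
    have := (abs_nonneg _).trans_lt (hslope t)
    exact div_ne_zero (abs_pos.1 this) (pow_ne_zero 2 (hrpos t).ne')
  -- Orient the longitude so that it increases along the curve.
  have hsgn : ∀ t, 0 < (n : ℝ) * ((T t 0 * T' t 1 - T t 1 * T' t 0) / r t ^ 2) := by
    have hθ0 := hθP 0
    rw [zero_add] at hθ0
    have hdiff : Differentiable ℝ θ := fun t => (hθd t).differentiableAt
    rcases hasDerivWithinAt_forall_lt_or_forall_gt_of_forall_ne convex_univ
      (fun t _ => (hθd t).hasDerivWithinAt) hθne with h | h
    · have : StrictAnti θ := strictAnti_of_deriv_neg fun t => by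
        rw [(hθd t).deriv]; exact h t trivial
      have := this hP
      have hn' : n = -1 := hn.resolve_left (by
        rintro rfl; push_cast at hθ0; linarith [Real.pi_pos])
      intro t
      rw [hn']; push_cast; linarith [h t trivial]
    · have : StrictMono θ := strictMono_of_deriv_pos fun t => by
        rw [(hθd t).deriv]; exact h t trivial
      have := this hP
      have hn' : n = 1 := hn.resolve_right (by
        rintro rfl; push_cast at hθ0; linarith [Real.pi_pos])
      intro t
      rw [hn']; push_cast; linarith [h t trivial]
  set η : ℝ → ℝ := fun t => n * θ t with hη
  have hηd : ∀ t, HasDerivAt η (n * ((T t 0 * T' t 1 - T t 1 * T' t 0) / r t ^ 2)) t :=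
    fun t => (hθd t).const_mul _
  have hηP : ∀ t, η (t + P) = η t + 2 * π := fun t => by
    simp only [hη, hθP]; linear_combination 2 * π * hn2
  have hητ : ∀ t, |T' t 2 / r t ^ 2| < n * ((T t 0 * T' t 1 - T t 1 * T' t 0) / r t ^ 2) :=
    fun t => by
    have habs : |(n : ℝ)| = 1 := by rcases hn with rfl | rfl <;> norm_num
    rw [← abs_of_pos (hsgn t), abs_mul, habs, one_mul, abs_div, abs_div]
    exact div_lt_div_of_pos_right (hslope t) (abs_pos.2 (pow_ne_zero 2 (hrpos t).ne'))
  have hadd : StrictMono fun t => η t + τ t := strictMono_of_deriv_pos fun t => by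
    rw [HasDerivAt.deriv (f := fun t => η t + τ t) ((hηd t).add (hτd t))]
    linarith [(abs_lt.1 (hητ t)).1]
  have hsub : StrictMono fun t => η t - τ t := strictMono_of_deriv_pos fun t => by
    rw [HasDerivAt.deriv (f := fun t => η t - τ t) ((hηd t).sub (hτd t))]
    linarith [(abs_lt.1 (hητ t)).2]
  have hτP : τ (a + P) = τ a := by simp only [hτ, hper a]
  have h1 := hadd hab
  have h2 := hsub hab
  have h3 := hadd hbP
  have h4 := hsub hbP
  simp only [hηP, hτP] at h1 h2 h3 h4
  have hcos : Real.cos (η b - η a) < Real.cos (τ b - τ a) := by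
    have h5 : |τ b - τ a| < η b - η a := abs_lt.2 ⟨by linarith, by linarith⟩
    have h6 : |τ b - τ a| < 2 * π - (η b - η a) := abs_lt.2 ⟨by linarith, by linarith⟩
    rw [← Real.cos_abs (τ b - τ a)]
    rcases le_total (η b - η a) π with h | h
    · exact Real.cos_lt_cos_of_nonneg_of_le_pi (abs_nonneg _) h h5
    · rw [← Real.cos_two_pi_sub (η b - η a)]
      exact Real.cos_lt_cos_of_nonneg_of_le_pi (abs_nonneg _) (by linarith) h6
  have hcosη : Real.cos (η b - η a) = Real.cos (θ b - θ a) := by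
    rcases hn with rfl | rfl
    · simp [hη]
    · rw [← Real.cos_neg (θ b - θ a)]; congr 1; simp only [hη]; push_cast; ring
  have hcosτ : r a * r b * Real.cos (τ b - τ a) = 1 + T a 2 * T b 2 := by
    have hc : ∀ t, Real.cos (τ t) = 1 / r t := fun t => by
      simp only [hτ]; rw [Real.cos_arctan, ← hrsq, Real.sqrt_sq (hrpos t).le]
    have hs : ∀ t, Real.sin (τ t) = T t 2 / r t := fun t => by
      simp only [hτ]; rw [Real.sin_arctan, ← hrsq, Real.sqrt_sq (hrpos t).le]
    have := (hrpos a).ne'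
    have := (hrpos b).ne'
    rw [Real.cos_sub, hc, hc, hs, hs]
    field_simp
  have hl : lorentz (T a) (T b) = r a * r b * Real.cos (θ b - θ a) - T a 2 * T b 2 := by
    have hx : ∀ t, T t 0 = r t * Real.cos (θ t) := fun t => (hcs t).1
    have hy : ∀ t, T t 1 = r t * Real.sin (θ t) := fun t => (hcs t).2
    simp only [lorentz, Real.cos_sub]
    linear_combination T b 0 * hx a + r a * Real.cos (θ a) * hx b + T b 1 * hy a
      + r a * Real.sin (θ a) * hy b
  have := mul_lt_mul_of_pos_left hcos (mul_pos (hrpos a) (hrpos b))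
  rw [hcosη] at this
  linarith

/-! ### Comparison with a spacelike great circle -/

/-- A function on an interval with values in `(-1, 1)` inside whose derivative dominates that of
the cosine of `S` is strictly monotone, and its arccosine changes by at least the increment
of `S`. -/
lemma arccos_sub_ge_of_sq_deriv_ge {u u' σ S : ℝ → ℝ} {a b : ℝ} (hab : a < b)
    (hu : ∀ t, HasDerivAt u (u' t) t) (hS : ∀ t, HasDerivAt S (σ t) t) (hσ : ∀ t, 0 < σ t)
    (hlt : ∀ t ∈ Set.Ioo a b, -1 < u t ∧ u t < 1)
    (hge : ∀ t, σ t ^ 2 * (1 - u t ^ 2) ≤ u' t ^ 2) :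
    (u b < u a ∧ S b - S a ≤ Real.arccos (u b) - Real.arccos (u a)) ∨
      (u a < u b ∧ S b - S a ≤ Real.arccos (u a) - Real.arccos (u b)) := by
  have hdec : ∀ v v' : ℝ → ℝ, (∀ t, HasDerivAt v (v' t) t) →
      (∀ t ∈ Set.Ioo a b, -1 < v t ∧ v t < 1) → (∀ t, σ t ^ 2 * (1 - v t ^ 2) ≤ v' t ^ 2) →
      (∀ t ∈ Set.Ioo a b, v' t < 0) →
      v b < v a ∧ S b - S a ≤ Real.arccos (v b) - Real.arccos (v a) := by
    intro v v' hv hvlt hvge hneg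
    have hvc : Continuous v := continuous_iff_continuousAt.2 fun t => (hv t).continuousAt
    have hSc : Continuous S := continuous_iff_continuousAt.2 fun t => (hS t).continuousAt
    refine ⟨?_, ?_⟩
    · refine strictAntiOn_of_deriv_neg (convex_Icc a b) hvc.continuousOn (fun t ht => ?_)
        (Set.left_mem_Icc.2 hab.le) (Set.right_mem_Icc.2 hab.le) hab
      rw [interior_Icc] at ht
      rw [(hv t).deriv]
      exact hneg t ht
    · have hmono : MonotoneOn (fun t => Real.arccos (v t) - S t) (Set.Icc a b) := by
        refine monotoneOn_of_hasDerivWithinAt_nonneg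
          (f' := fun t => -(1 / √(1 - v t ^ 2)) * v' t - σ t) (convex_Icc a b)
          ((Real.continuous_arccos.comp hvc).sub hSc).continuousOn (fun t ht => ?_)
          (fun t ht => ?_)
        · rw [interior_Icc] at ht
          obtain ⟨h1, h2⟩ := hvlt t ht
          exact (((Real.hasDerivAt_arccos h1.ne' h2.ne).comp t (hv t)).sub
            (hS t)).hasDerivWithinAt
        · rw [interior_Icc] at ht
          obtain ⟨h1, h2⟩ := hvlt t ht
          have h3 : 0 < 1 - v t ^ 2 := by nlinarith
          have h4 := Real.sqrt_pos.2 h3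
          have h5 : σ t * √(1 - v t ^ 2) ≤ -v' t := by
            refine abs_le_of_sq_le_sq' ?_ (neg_nonneg.2 (hneg t ht).le) |>.2
            rw [mul_pow, Real.sq_sqrt h3.le, neg_sq]
            exact hvge t
          have h6 := (le_div_iff₀ h4).2 h5
          have h7 : -(1 / √(1 - v t ^ 2)) * v' t = -v' t / √(1 - v t ^ 2) := by ring
          rw [h7]
          linarith
      have := hmono (Set.left_mem_Icc.2 hab.le) (Set.right_mem_Icc.2 hab.le) hab.le
      simp only at this
      linarith
  have hne : ∀ t ∈ Set.Ioo a b, u' t ≠ 0 := fun t ht h0 => by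
    obtain ⟨h1, h2⟩ := hlt t ht
    have h3 := hge t
    have : 0 < σ t ^ 2 * (1 - u t ^ 2) := mul_pos (pow_pos (hσ t) 2) (by nlinarith)
    rw [h0] at h3
    linarith
  rcases hasDerivWithinAt_forall_lt_or_forall_gt_of_forall_ne (convex_Ioo a b)
    (fun t _ => (hu t).hasDerivWithinAt) hne with h | h
  · exact Or.inl (hdec u u' hu hlt hge h)
  · have := hdec (fun t => -u t) (fun t => -u' t) (fun t => (hu t).neg)
      (fun t ht => ⟨by linarith [(hlt t ht).2], by linarith [(hlt t ht).1]⟩)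
      (fun t => by simpa using hge t) (fun t ht => by linarith [h t ht])
    simp only [Real.arccos_neg] at this
    exact Or.inr ⟨by linarith, by linarith⟩

/-- If the derivative of `u` is dominated by that of the cosine of `S`, then `u` needs an
increment `π` of `S` to descend to `-1`. -/
lemma pi_le_sub_of_sq_deriv_le {u u' σ S : ℝ → ℝ} {a b : ℝ} (hab : a ≤ b)
    (hu : ∀ t, HasDerivAt u (u' t) t) (hS : ∀ t, HasDerivAt S (σ t) t) (hσ : ∀ t, 0 < σ t)
    (hua : u a = 1) (hub : u b ≤ -1) (hlt : ∀ t ∈ Set.Ioc a b, u t < 1)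
    (hle : ∀ t, u' t ^ 2 ≤ σ t ^ 2 * (1 - u t ^ 2)) : π ≤ S b - S a := by
  have huc : Continuous u := continuous_iff_continuousAt.2 fun t => (hu t).continuousAt
  have hSc : Continuous S := continuous_iff_continuousAt.2 fun t => (hS t).continuousAt
  have hSm : StrictMono S := strictMono_of_deriv_pos fun t => by rw [(hS t).deriv]; exact hσ t
  obtain ⟨c, ⟨⟨hac, hcb⟩, huc1⟩, hcmin⟩ :=
    (isCompact_Icc.inter_right (isClosed_le huc continuous_const) :
      IsCompact (Set.Icc a b ∩ {t | u t ≤ -1})).exists_isLeast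
      ⟨b, Set.right_mem_Icc.2 hab, hub⟩
  have huc1 : u c ≤ -1 := huc1
  have hin : ∀ t ∈ Set.Ioo a c, -1 < u t ∧ u t < 1 := fun t ht => by
    refine ⟨?_, hlt t ⟨ht.1, ht.2.le.trans hcb⟩⟩
    by_contra hcon
    exact absurd (hcmin ⟨⟨ht.1.le, ht.2.le.trans hcb⟩, not_lt.1 hcon⟩) (not_le.2 ht.2)
  have hanti : AntitoneOn (fun t => Real.arccos (u t) - S t) (Set.Icc a c) := by
    refine antitoneOn_of_hasDerivWithinAt_nonpos
      (f' := fun t => -(1 / √(1 - u t ^ 2)) * u' t - σ t) (convex_Icc a c)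
      ((Real.continuous_arccos.comp huc).sub hSc).continuousOn (fun t ht => ?_)
      (fun t ht => ?_)
    · rw [interior_Icc] at ht
      obtain ⟨h1, h2⟩ := hin t ht
      exact (((Real.hasDerivAt_arccos h1.ne' h2.ne).comp t (hu t)).sub (hS t)).hasDerivWithinAt
    · rw [interior_Icc] at ht
      obtain ⟨h1, h2⟩ := hin t ht
      have h3 : 0 < 1 - u t ^ 2 := by nlinarith
      have h4 := Real.sqrt_pos.2 h3
      have h5 : -(σ t * √(1 - u t ^ 2)) ≤ u' t := by
        refine abs_le_of_sq_le_sq' ?_ (mul_pos (hσ t) h4).le |>.1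
        rw [mul_pow, Real.sq_sqrt h3.le]
        exact hle t
      have h6 := (div_le_iff₀ h4).2 (neg_le.1 h5)
      have h7 : -(1 / √(1 - u t ^ 2)) * u' t = -u' t / √(1 - u t ^ 2) := by ring
      rw [h7]
      linarith
  have := hanti (Set.left_mem_Icc.2 hac) (Set.right_mem_Icc.2 hac) hac
  simp only [hua, Real.arccos_one, Real.arccos_of_le_neg_one huc1] at this
  linarith [hSm.monotone hcb]

lemma mem_of_hasDerivAt {f : ℝ → Space} {f' : Space} {t : ℝ} {W : Submodule ℝ Space}
    (hf : HasDerivAt f f' t) (hW : ∀ s, f s - f t ∈ W) : f' ∈ W := by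
  have hcl : IsClosed (W : Set Space) := W.closed_of_finiteDimensional
  refine hcl.mem_of_tendsto (hasDerivAt_iff_tendsto_slope.1 hf) (Filter.Eventually.of_forall
    fun s => ?_)
  rw [slope_def_module]
  exact W.smul_mem _ (hW s)

/-- A closed spacelike curve `T` of period `P` and length `L` on the de Sitter sphere, all of
whose chords are spacelike, with derivative `T'`, speed `σ` and arc length `S`. -/
structure IsAchronalLoop (T T' : ℝ → Space) (σ S : ℝ → ℝ) (P L : ℝ) : Prop where
  period_pos : 0 < P
  hasDerivAt : ∀ t, HasDerivAt T (T' t) t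
  unit : ∀ t, lorentz (T t) (T t) = 1
  speed_pos : ∀ t, 0 < σ t
  speed_sq : ∀ t, σ t ^ 2 = lorentz (T' t) (T' t)
  hasDerivAt_length : ∀ t, HasDerivAt S (σ t) t
  periodic : Function.Periodic T P
  length_add : ∀ t, S (t + P) = S t + L
  chord : ∀ a b, a < b → b < a + P → lorentz (T a) (T b) < 1

namespace IsAchronalLoop

variable {T T' : ℝ → Space} {σ S : ℝ → ℝ} {P L : ℝ} (h : IsAchronalLoop T T' σ S P L)
include h

lemma orthogonal (t : ℝ) : lorentz (T t) (T' t) = 0 := by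
  have h1 := hasDerivAt_lorentz (h.hasDerivAt t) (h.hasDerivAt t)
  simp only [h.unit] at h1
  have h2 := h1.unique (hasDerivAt_const t 1)
  rw [lorentz_comm (T' t)] at h2
  linarith

lemma gram (X : Space) (t : ℝ) :
    (lorentz X X - lorentz X (T t) ^ 2) * σ t ^ 2 - lorentz X (T' t) ^ 2
      = -lorentz (lorentzCross (T t) (T' t)) X ^ 2 := by
  rw [h.speed_sq, gram_eq_neg_sq (h.unit t) (h.orthogonal t)]

lemma strictMono_length : StrictMono S := strictMono_of_deriv_pos fun t => by
  rw [(h.hasDerivAt_length t).deriv]; exact h.speed_pos t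

lemma continuous_length : Continuous S :=
  continuous_iff_continuousAt.2 fun t => (h.hasDerivAt_length t).continuousAt

/-- The curve leaves each of its points at least as fast as a great circle does. -/
lemma sq_deriv_ge (a t : ℝ) :
    σ t ^ 2 * (1 - lorentz (T a) (T t) ^ 2) ≤ lorentz (T a) (T' t) ^ 2 := by
  have := h.gram (T a) t
  rw [h.unit] at this
  nlinarith [sq_nonneg (lorentz (lorentzCross (T t) (T' t)) (T a))]

lemma lorentz_add_period (a : ℝ) : lorentz (T a) (T (a + P)) = 1 := by
  rw [h.periodic, h.unit]

/-- The reversed comparison for a long loop: a point at distance at most half of the length from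
`T a` along the curve is at least as far from `T a` as it would be on a great circle. -/
lemma lorentz_le_cos (hL : 2 * π ≤ L) {a b : ℝ} (hab : a < b) (hS : S b - S a ≤ L / 2) :
    lorentz (T a) (T b) ≤ Real.cos (min (S b - S a) π) := by
  have hπ := Real.pi_pos
  set u : ℝ → ℝ := fun t => lorentz (T a) (T t) with hu
  have hu1 : u a = 1 := h.unit a
  have hd : ∀ t, HasDerivAt u (lorentz (T a) (T' t)) t := fun t =>
    hasDerivAt_lorentz_const (T a) (h.hasDerivAt t)
  have huc : Continuous u := continuous_iff_continuousAt.2 fun t => (hd t).continuousAt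
  have hbP : b < a + P := h.strictMono_length.lt_iff_lt.1 (by
    rw [h.length_add]; linarith)
  have hphase := fun {c d : ℝ} (hcd : c < d) (hlt : ∀ t ∈ Set.Ioo c d, -1 < u t ∧ u t < 1) =>
    arccos_sub_ge_of_sq_deriv_ge hcd hd h.hasDerivAt_length h.speed_pos hlt (h.sq_deriv_ge a)
  change u b ≤ _
  by_cases hb : u b ≤ -1
  · exact hb.trans (Real.neg_one_le_cos _)
  rw [not_le] at hb
  by_cases hc : ∀ t ∈ Set.Ioo a b, -1 < u t
  · -- The curve has not yet met the light cone of the antipode of `T a`.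
    have hub : u b < 1 := h.chord a b hab hbP
    rcases hphase hab fun t ht => ⟨hc t ht, h.chord a t ht.1 (ht.2.trans hbP)⟩ with h1 | h1
    · have h2 := h1.2
      rw [hu1, Real.arccos_one, sub_zero] at h2
      rw [min_eq_left (h2.trans (Real.arccos_le_pi _)), ← Real.cos_arccos hb.le hub.le]
      exact Real.cos_le_cos_of_nonneg_of_le_pi
        (sub_nonneg.2 (h.strictMono_length.monotone hab.le)) (Real.arccos_le_pi _) h2
    · linarith [h1.1]
  · -- The curve has met that light cone and left it again, at time `c`. From there it needs at
    -- most the length `π` to close up, so that `c` is beyond half of the loop.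
    exfalso
    push Not at hc
    obtain ⟨t₀, ht₀, hut₀⟩ := hc
    obtain ⟨c, ⟨⟨hac, hcb⟩, huc1⟩, hcmax⟩ :=
      (isCompact_Icc.inter_right (isClosed_le huc continuous_const) :
        IsCompact (Set.Icc a b ∩ {t | u t ≤ -1})).exists_isGreatest ⟨t₀, ⟨ht₀.1.le, ht₀.2.le⟩, hut₀⟩
    have huc1 : u c ≤ -1 := huc1
    have hac : a < c := hac.lt_of_ne (by rintro rfl; linarith)
    have hcb : c < b := hcb.lt_of_ne (by rintro rfl; linarith)
    have hcb1 : ∀ t, c < t → t ≤ b → -1 < u t := fun t hct htb => by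
      by_contra hcon
      exact absurd (hcmax ⟨⟨hac.le.trans hct.le, htb⟩, not_lt.1 hcon⟩) (not_le.2 hct)
    have hout : ∀ t ∈ Set.Ioo c (a + P), -1 < u t := by
      intro t ht
      by_contra hcon
      rw [not_lt] at hcon
      have hbt : b ≤ t := by
        by_contra hlt
        exact absurd (hcb1 t ht.1 (not_le.1 hlt).le) (not_lt.2 hcon)
      obtain ⟨d, ⟨⟨hbd, hdt⟩, hud⟩, hdmin⟩ :=
        (isCompact_Icc.inter_right (isClosed_le huc continuous_const) :
          IsCompact (Set.Icc b t ∩ {t | u t ≤ -1})).exists_isLeast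
          ⟨t, Set.right_mem_Icc.2 hbt, hcon⟩
      have hud : u d ≤ -1 := hud
      have hcd : ∀ s ∈ Set.Ioo c d, -1 < u s ∧ u s < 1 := by
        intro s hs
        refine ⟨?_, h.chord a s (hac.trans hs.1) ((hs.2.trans_le hdt).trans ht.2)⟩
        rcases le_total s b with hsb | hsb
        · exact hcb1 s hs.1 hsb
        · by_contra hcon'
          exact absurd (hdmin ⟨⟨hsb, hs.2.le.trans hdt⟩, not_lt.1 hcon'⟩) (not_le.2 hs.2)
      have hSm := h.strictMono_length (hcb.trans_le hbd)
      rcases hphase (hcb.trans_le hbd) hcd with h1 | h1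
      · have := h1.2
        rw [Real.arccos_of_le_neg_one huc1, Real.arccos_of_le_neg_one hud] at this
        linarith
      · have := h1.2
        rw [Real.arccos_of_le_neg_one huc1, Real.arccos_of_le_neg_one hud] at this
        linarith
    have huP : u (a + P) = 1 := h.lorentz_add_period a
    have hSm := h.strictMono_length hcb
    rcases hphase (hcb.trans hbP) fun t ht =>
      ⟨hout t ht, h.chord a t (hac.trans ht.1) ht.2⟩ with h1 | h1
    · linarith [h1.1]
    · have := h1.2
      rw [huP, Real.arccos_one, Real.arccos_of_le_neg_one huc1, h.length_add] at this
      linarith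

lemma exists_length_eq {a x : ℝ} (h0 : 0 < x) (hx : x < L) :
    ∃ b, a < b ∧ b < a + P ∧ S b = S a + x := by
  have hle : a ≤ a + P := (lt_add_of_pos_right a h.period_pos).le
  obtain ⟨b, -, hb⟩ := intermediate_value_Icc hle h.continuous_length.continuousOn
    (show S a + x ∈ Set.Icc (S a) (S (a + P)) by
      rw [h.length_add]; exact ⟨by linarith, by linarith⟩)
  refine ⟨b, h.strictMono_length.lt_iff_lt.1 (by linarith),
    h.strictMono_length.lt_iff_lt.1 (by rw [h.length_add]; linarith), hb⟩

omit h in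
lemma cos_min_add_cos_min_le {x y : ℝ} (hx : 0 ≤ x) (hy : 0 ≤ y) (hxy : π ≤ x + y) :
    Real.cos (min x π) + Real.cos (min y π) ≤ 0 := by
  have hπ := Real.pi_pos
  have h1 : π - min x π ≤ min y π := by
    rcases le_total x π with h1 | h1 <;> rcases le_total y π with h2 | h2 <;>
      simp only [h1, h2, min_eq_left, min_eq_right] <;> linarith
  have h2 := Real.cos_le_cos_of_nonneg_of_le_pi (by linarith [min_le_right x π])
    (min_le_right y π) h1
  rw [Real.cos_pi_sub] at h2
  linarith

/-- Two points that halve a loop of length at least `2π` have a sum whose product with all points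
of the loop is nonpositive. -/
lemma lorentz_add_le_zero (hL : 2 * π ≤ L) {a b : ℝ} (hS : S b = S a + L / 2) (t : ℝ) :
    lorentz (T a + T b) (T t) ≤ 0 := by
  have hπ := Real.pi_pos
  -- Away from the endpoints of an arc, apply the comparison from both of them.
  have harc : ∀ p q t, S q = S p + L / 2 → p < t → t < q → lorentz (T p + T q) (T t) ≤ 0 := by
    intro p q t hpq hpt htq
    have h1 := h.strictMono_length hpt
    have h2 := h.strictMono_length htq
    rw [lorentz_add_left, lorentz_comm (T q)]
    have h3 := h.lorentz_le_cos hL hpt (by linarith)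
    have h4 := h.lorentz_le_cos hL htq (by linarith)
    have h5 := cos_min_add_cos_min_le (x := S t - S p) (y := S q - S t) (by linarith)
      (by linarith) (by linarith)
    linarith
  have hend : ∀ p q, S q = S p + L / 2 → lorentz (T p) (T q) ≤ -1 := by
    intro p q hpq
    have h1 := h.lorentz_le_cos hL (h.strictMono_length.lt_iff_lt.1 (by linarith : S p < S q))
      (by linarith)
    rwa [hpq, add_sub_cancel_left, min_eq_right (by linarith), Real.cos_pi] at h1
  have hper : Function.Periodic (fun t => lorentz (T a + T b) (T t)) P := fun t => by
    simp only [h.periodic t]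
  obtain ⟨s, ⟨has, hsP⟩, hs⟩ := hper.exists_mem_Ico h.period_pos t a
  refine (le_of_eq hs).trans ?_
  change lorentz (T a + T b) (T s) ≤ 0
  have hab := hend a b hS
  rcases has.eq_or_lt with rfl | has
  · rw [lorentz_add_left, h.unit, lorentz_comm]; linarith
  rcases lt_trichotomy s b with hsb | rfl | hsb
  · exact harc a b s hS has hsb
  · rw [lorentz_add_left, h.unit]; linarith
  · have := harc b (a + P) s (by rw [h.length_add]; linarith) hsb hsP
    rwa [h.periodic, add_comm] at this

/-! ### Tangent indicatrices of closed curves -/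

/-- If the loop is the tangent indicatrix of a closed curve, the product in
`lorentz_add_le_zero` vanishes, as its integral along the closed curve is zero. -/
lemma lorentz_add_eq_zero {γ : ℝ → Space} {v : ℝ → ℝ} (hv : ∀ t, 0 < v t)
    (hγ : ∀ t, HasDerivAt γ (v t • T t) t) (hγP : Function.Periodic γ P)
    (hL : 2 * π ≤ L) {a b : ℝ} (hS : S b = S a + L / 2) (t : ℝ) :
    lorentz (T a + T b) (T t) = 0 := by
  set w := T a + T b
  set g : ℝ → ℝ := fun t => lorentz w (γ t) with hg
  have hd : ∀ t, HasDerivAt g (v t * lorentz w (T t)) t := fun t => by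
    rw [← lorentz_smul_right]; exact hasDerivAt_lorentz_const w (hγ t)
  have hanti : Antitone g := antitone_of_hasDerivAt_nonpos hd fun t =>
    mul_nonpos_of_nonneg_of_nonpos (hv t).le (h.lorentz_add_le_zero hL hS t)
  have hgP : ∀ t, g (t + P) = g t := fun t => by simp only [hg, hγP t]
  have hconst : g =ᶠ[nhds t] fun _ => g t := by
    filter_upwards [Icc_mem_nhds (sub_lt_self t h.period_pos)
      (lt_add_of_pos_right t h.period_pos)] with s hs
    rcases le_total s t with hst | hst
    · refine le_antisymm ?_ (hanti hst)
      have h1 := hanti hs.1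
      have h2 := hgP (t - P)
      rw [sub_add_cancel] at h2
      linarith
    · refine le_antisymm (hanti hst) ?_
      rw [← hgP t]
      exact hanti hs.2
  have := (hd t).unique ((hasDerivAt_const t (g t)).congr_of_eventuallyEq hconst)
  exact (mul_eq_zero.1 this).resolve_left (hv t).ne'

/-- The reversed Fenchel inequality. -/
lemma length_le_two_pi {γ : ℝ → Space} {v : ℝ → ℝ} (hv : ∀ t, 0 < v t)
    (hγ : ∀ t, HasDerivAt γ (v t • T t) t) (hγP : Function.Periodic γ P) : L ≤ 2 * π := by
  by_contra hL
  rw [not_le] at hL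
  have hπ := Real.pi_pos
  obtain ⟨b, -, hbP, hb⟩ := h.exists_length_eq (a := 0) (x := L / 2) (by linarith) (by linarith)
  obtain ⟨t, hat, -, ht⟩ := h.exists_length_eq (a := 0) (x := L / 2 - π) (by linarith)
    (by linarith)
  have htb : t < b := h.strictMono_length.lt_iff_lt.1 (by linarith)
  have h0 := h.lorentz_add_eq_zero hv hγ hγP hL.le hb t
  have h1 := h.chord 0 t hat (htb.trans hbP)
  have h2 := h.lorentz_le_cos hL.le htb (by linarith)
  rw [show S b - S t = π by linarith, min_self, Real.cos_pi] at h2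
  rw [lorentz_add_left, lorentz_comm (T b)] at h0
  linarith

/-- In a loop of length `2π`, points at distance `π` are antipodal: their sum is a vector of
a spacelike plane that is orthogonal to itself. -/
lemma add_eq_zero {γ : ℝ → Space} {v : ℝ → ℝ} (hv : ∀ t, 0 < v t)
    (hγ : ∀ t, HasDerivAt γ (v t • T t) t) (hγP : Function.Periodic γ P)
    (hplane : ∀ t, IsSpacelikePlane (Submodule.span ℝ {T t, T' t}))
    (hL : L = 2 * π) {a b : ℝ} (hS : S b = S a + π) : T a + T b = 0 := by
  have hw := h.lorentz_add_eq_zero hv hγ hγP hL.ge (a := a) (b := b) (by linarith)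
  have hw' : lorentz (T a + T b) (T' a) = 0 := by
    have h1 := hasDerivAt_lorentz_const (T a + T b) (h.hasDerivAt a)
    simp only [hw] at h1
    exact h1.unique (hasDerivAt_const a 0)
  have hww : lorentz (T a + T b) (T a + T b) = 0 := by
    rw [lorentz_add_left, lorentz_comm (T a), lorentz_comm (T b), hw, hw, add_zero]
  have hg := h.gram (T a + T b) a
  rw [hww, hw, hw'] at hg
  have hker : lorentz (lorentzCross (T a) (T' a)) (T a + T b) = 0 := by
    have : lorentz (lorentzCross (T a) (T' a)) (T a + T b) ^ 2 = 0 := by linarith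
    exact pow_eq_zero_iff two_ne_zero |>.1 this
  by_contra hne
  have hmem : T a + T b ∈ Submodule.span ℝ {T a, T' a} := by
    rw [span_eq_ker_lorentzForm (h.unit a) (h.orthogonal a)
      (by rw [← h.speed_sq]; exact pow_pos (h.speed_pos a) 2) (hplane a).1]
    exact hker
  exact ((hplane a).2 _ hmem hne).ne' hww

/-- A loop of length `2π` is isometric to a great circle. -/
lemma lorentz_eq_cos {γ : ℝ → Space} {v : ℝ → ℝ} (hv : ∀ t, 0 < v t)
    (hγ : ∀ t, HasDerivAt γ (v t • T t) t) (hγP : Function.Periodic γ P)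
    (hplane : ∀ t, IsSpacelikePlane (Submodule.span ℝ {T t, T' t}))
    (hL : L = 2 * π) (a t : ℝ) : lorentz (T a) (T t) = Real.cos (S t - S a) := by
  have hπ := Real.pi_pos
  have hanti := fun {a b : ℝ} => h.add_eq_zero hv hγ hγP hplane hL (a := a) (b := b)
  have hneg : ∀ {a b : ℝ}, S b = S a + π → ∀ X, lorentz (T a) X = -lorentz (T b) X := by
    intro a b hab X
    have h1 : lorentz (T a + T b) X = 0 := by rw [hanti hab]; simp [lorentz]
    rw [lorentz_add_left] at h1
    linarith
  -- On a half of the loop, compare with both endpoints.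
  have hhalf : ∀ a b t, S b = S a + π → a ≤ t → t ≤ b →
      lorentz (T a) (T t) = Real.cos (S t - S a) := by
    intro a b t hab hat htb
    have hle : ∀ p q, p ≤ q → S q - S p ≤ π → lorentz (T p) (T q) ≤ Real.cos (S q - S p) := by
      intro p q hpq hS
      rcases hpq.eq_or_lt with rfl | hpq
      · rw [h.unit, sub_self, Real.cos_zero]
      · have := h.lorentz_le_cos hL.ge hpq (by linarith)
        rwa [min_eq_left hS] at this
    have h1 := h.strictMono_length.monotone hat
    have h2 := h.strictMono_length.monotone htb
    refine le_antisymm (hle a t hat (by linarith)) ?_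
    have h3 := hle t b htb (by linarith)
    rw [lorentz_comm, show S b - S t = π - (S t - S a) by linarith, Real.cos_pi_sub] at h3
    rw [hneg hab]
    linarith
  have hper : Function.Periodic (fun t => lorentz (T a) (T t) - Real.cos (S t - S a)) P :=
    fun t => by
      simp only [h.periodic t, h.length_add t, hL]
      rw [add_sub_right_comm, Real.cos_add_two_pi]
  obtain ⟨s, ⟨has, hsP⟩, hs⟩ := hper.exists_mem_Ico h.period_pos t a
  have hs : lorentz (T a) (T t) - Real.cos (S t - S a)
    = lorentz (T a) (T s) - Real.cos (S s - S a) := hs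
  suffices lorentz (T a) (T s) = Real.cos (S s - S a) by linarith
  obtain ⟨b, hab, hbP, hb⟩ := h.exists_length_eq (a := a) (x := π) hπ (by linarith)
  rcases le_total s b with hsb | hsb
  · exact hhalf a b s hb has hsb
  · have h1 := hhalf b (a + P) s (by rw [h.length_add]; linarith) hsb hsP.le
    rw [hneg hb, h1, hb, ← Real.cos_add_pi]
    rw [show S s - (S a + π) + π = S s - S a by ring]

/-- A closed curve whose tangent indicatrix has length `2π` is a convex curve in a spacelike
plane. -/
lemma exists_isConvexCurveIn {γ : ℝ → Space} {v : ℝ → ℝ} (hv : ∀ t, 0 < v t)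
    (hγ : ∀ t, HasDerivAt γ (v t • T t) t) (hγP : Function.Periodic γ P)
    (hplane : ∀ t, IsSpacelikePlane (Submodule.span ℝ {T t, T' t})) (hL : L = 2 * π) :
    ∃ E : AffineSubspace ℝ Space, IsSpacelikePlane E.direction ∧ IsConvexCurveIn E γ P := by
  have hπ := Real.pi_pos
  have hcos := h.lorentz_eq_cos hv hγ hγP hplane hL
  have hsin : ∀ a t, lorentz (T' a) (T t) = σ a * Real.sin (S t - S a) := by
    intro a t
    have h1 := hasDerivAt_lorentz (h.hasDerivAt a) (hasDerivAt_const a (T t))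
    simp only [hcos] at h1
    have h2 := ((h.hasDerivAt_length a).const_sub (S t)).cos
    have h3 := h1.unique h2
    have h4 : lorentz (T a) 0 = 0 := by simp [lorentz]
    rw [h4] at h3
    linarith
  -- All tangent vectors lie in the plane spanned by `T 0` and `T' 0`.
  have hdet : ∀ t, lorentz (lorentzCross (T 0) (T' 0)) (T t) = 0 := by
    intro t
    have h1 := h.gram (T t) 0
    rw [h.unit, lorentz_comm (T t) (T' 0), hsin, lorentz_comm, hcos] at h1
    have h2 : lorentz (lorentzCross (T 0) (T' 0)) (T t) ^ 2 = 0 := by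
      linear_combination h1 + σ 0 ^ 2 * Real.sin_sq_add_cos_sq (S t - S 0)
    exact pow_eq_zero_iff two_ne_zero |>.1 h2
  have hdet' : ∀ t, lorentz (lorentzCross (T 0) (T' 0)) (T' t) = 0 := by
    intro t
    have h1 := hasDerivAt_lorentz_const (lorentzCross (T 0) (T' 0)) (h.hasDerivAt t)
    simp only [hdet] at h1
    exact h1.unique (hasDerivAt_const t 0)
  have hspan := span_eq_ker_lorentzForm (h.unit 0) (h.orthogonal 0)
    (by rw [← h.speed_sq]; exact pow_pos (h.speed_pos 0) 2) (hplane 0).1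
  -- The height over the tangent line at `t` increases on the first half of the loop and
  -- decreases on the second.
  have hheight : ∀ t u, HasDerivAt (fun u => lorentz (T' t) (γ u))
      (v u * (σ t * Real.sin (S u - S t))) u := by
    intro t u
    rw [← hsin, ← lorentz_smul_right]
    exact hasDerivAt_lorentz_const _ (hγ u)
  have hpos : ∀ t u, t < u → u < t + P → lorentz (T' t) (γ t) < lorentz (T' t) (γ u) := by
    intro t u htu huP
    obtain ⟨b, htb, hbP, hb⟩ := h.exists_length_eq (a := t) (x := π) hπ (by linarith)
    have hcont : Continuous fun u => lorentz (T' t) (γ u) :=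
      continuous_iff_continuousAt.2 fun u => (hheight t u).continuousAt
    rcases le_total u b with hub | hub
    · refine strictMonoOn_of_deriv_pos (convex_Icc t b) hcont.continuousOn (fun s hs => ?_)
        (Set.left_mem_Icc.2 htb.le) ⟨htu.le, hub⟩ htu
      rw [interior_Icc] at hs
      rw [(hheight t s).deriv]
      have h1 := h.strictMono_length hs.1
      have h2 := h.strictMono_length hs.2
      exact mul_pos (hv s) (mul_pos (h.speed_pos t)
        (Real.sin_pos_of_pos_of_lt_pi (by linarith) (by linarith)))
    · have : lorentz (T' t) (γ (t + P)) < lorentz (T' t) (γ u) := by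
        refine strictAntiOn_of_deriv_neg (convex_Icc b (t + P)) hcont.continuousOn
          (fun s hs => ?_) ⟨hub, huP.le⟩ (Set.right_mem_Icc.2 hbP.le) huP
        rw [interior_Icc] at hs
        rw [(hheight t s).deriv]
        have h1 := h.strictMono_length hs.1
        have h2 := h.strictMono_length hs.2
        rw [h.length_add] at h2
        have h3 := Real.sin_pos_of_pos_of_lt_pi (x := S s - S t - π) (by linarith)
          (by linarith)
        rw [Real.sin_sub_pi] at h3
        exact mul_neg_of_pos_of_neg (hv s) (mul_neg_of_pos_of_neg (h.speed_pos t)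
          (by linarith))
      rwa [hγP] at this
  refine ⟨AffineSubspace.mk' (γ 0) (Submodule.span ℝ {T 0, T' 0}), ?_, ?_, ?_, ?_⟩
  · rw [AffineSubspace.direction_mk']
    exact hplane 0
  · intro t
    rw [AffineSubspace.mem_mk', hspan, LinearMap.mem_ker, vsub_eq_sub, map_sub, sub_eq_zero]
    have hd : ∀ t, HasDerivAt (fun t => lorentz (lorentzCross (T 0) (T' 0)) (γ t)) 0 t :=
      fun t => by
        have := hasDerivAt_lorentz_const (lorentzCross (T 0) (T' 0)) (hγ t)
        rwa [lorentz_smul_right, hdet, mul_zero] at this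
    exact is_const_of_deriv_eq_zero (fun t => (hd t).differentiableAt) (fun t => (hd t).deriv) t 0
  · have hlt : ∀ x ∈ Set.Ico 0 P, ∀ y ∈ Set.Ico 0 P, x < y → γ x ≠ γ y := by
      intro x hx y hy hxy heq
      have := hpos x y hxy (by linarith [hx.1, hy.2])
      rw [heq] at this
      exact lt_irrefl _ this
    intro x hx y hy heq
    rcases lt_trichotomy x y with hxy | hxy | hxy
    · exact absurd heq (hlt x hx y hy hxy)
    · exact hxy
    · exact absurd heq.symm (hlt y hy x hx hxy)
  · intro t
    refine ⟨lorentzForm (T' t), ⟨T' t, ?_, ?_⟩, ?_, fun u => ?_⟩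
    · rw [AffineSubspace.direction_mk', hspan]
      exact hdet' t
    · rw [lorentzForm_apply, ← h.speed_sq]
      exact (pow_pos (h.speed_pos t) 2).ne'
    · rw [(hγ t).deriv, lorentzForm_apply, lorentz_smul_right, lorentz_comm, h.orthogonal,
        mul_zero]
    · rw [map_sub, sub_nonneg, lorentzForm_apply, lorentzForm_apply]
      obtain ⟨s, ⟨hts, hsP⟩, hs⟩ := hγP.exists_mem_Ico h.period_pos u t
      rw [hs]
      rcases hts.eq_or_lt with rfl | hts
      · exact le_rfl
      · exact (hpos t s hts hsP).le

/-- A loop in a spacelike plane has length at least `2π`: it has to pass through the antipode of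
its starting point, which costs `π`, and back. -/
lemma two_pi_le_length {W : Submodule ℝ Space} (hW : IsSpacelikePlane W) (hT : ∀ t, T t ∈ W) :
    2 * π ≤ L := by
  have hT' : ∀ t, T' t ∈ W := fun t =>
    mem_of_hasDerivAt (h.hasDerivAt t) fun s => W.sub_mem (hT s) (hT t)
  have hnonneg : ∀ X ∈ W, 0 ≤ lorentz X X := fun X hX => by
    rcases eq_or_ne X 0 with rfl | hne
    · simp [lorentz]
    · exact (hW.2 X hX hne).le
  -- Bessel's inequality in the plane.
  have hle : ∀ a t, lorentz (T a) (T' t) ^ 2 ≤ σ t ^ 2 * (1 - lorentz (T a) (T t) ^ 2) := by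
    intro a t
    have h1 := hnonneg _ (W.sub_mem (W.smul_mem (σ t ^ 2) (hT a))
      (W.add_mem (W.smul_mem (σ t ^ 2 * lorentz (T a) (T t)) (hT t))
        (W.smul_mem (lorentz (T a) (T' t)) (hT' t))))
    have hσ := pow_pos (h.speed_pos t) 2
    have h2 : ∀ X Y Z : Space, ∀ s : ℝ, lorentz Y Z = 0 →
        lorentz (s • X - ((s * lorentz X Y) • Y + lorentz X Z • Z))
          (s • X - ((s * lorentz X Y) • Y + lorentz X Z • Z))
        = s ^ 2 * lorentz X X - 2 * s ^ 2 * lorentz X Y ^ 2 - 2 * s * lorentz X Z ^ 2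
          + s ^ 2 * lorentz X Y ^ 2 * lorentz Y Y + lorentz X Z ^ 2 * lorentz Z Z := by
      intro X Y Z s hYZ
      have h3 : lorentz (s • X - ((s * lorentz X Y) • Y + lorentz X Z • Z))
          (s • X - ((s * lorentz X Y) • Y + lorentz X Z • Z))
        = s ^ 2 * lorentz X X - 2 * s ^ 2 * lorentz X Y ^ 2 - 2 * s * lorentz X Z ^ 2
          + s ^ 2 * lorentz X Y ^ 2 * lorentz Y Y + lorentz X Z ^ 2 * lorentz Z Z
          + 2 * s * lorentz X Y * lorentz X Z * lorentz Y Z := by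
        generalize hp : lorentz X Y = p
        generalize hq : lorentz X Z = q
        simp only [lorentz, Pi.sub_apply, Pi.add_apply, Pi.smul_apply, smul_eq_mul] at hp hq ⊢
        linear_combination (-2 * s ^ 2 * p) * hp - 2 * s * q * hq
      rw [h3, hYZ, mul_zero, add_zero]
    rw [h2 _ _ _ _ (h.orthogonal t), h.unit, h.unit, ← h.speed_sq] at h1
    have h4 : 0 ≤ σ t ^ 2 *
        (σ t ^ 2 * (1 - lorentz (T a) (T t) ^ 2) - lorentz (T a) (T' t) ^ 2) := by
      linarith
    linarith [nonneg_of_mul_nonneg_right h4 hσ]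
  have hd : ∀ a t, HasDerivAt (fun t => lorentz (T a) (T t)) (lorentz (T a) (T' t)) t :=
    fun a t => hasDerivAt_lorentz_const (T a) (h.hasDerivAt t)
  have hreach : ∀ a b, a ≤ b → b < a + P → lorentz (T a) (T b) ≤ -1 → π ≤ S b - S a := by
    intro a b hab hbP hub
    exact pi_le_sub_of_sq_deriv_le hab (hd a) h.hasDerivAt_length h.speed_pos (h.unit a) hub
      (fun t ht => h.chord a t ht.1 (ht.2.trans_lt hbP)) (hle a)
  obtain ⟨b, hb, hub⟩ : ∃ b ∈ Set.Ioo 0 P, lorentz (T 0) (T b) ≤ -1 := by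
    by_contra! hcon
    have hP1 := h.lorentz_add_period 0
    rw [zero_add] at hP1
    have h01 := h.unit 0
    rcases arccos_sub_ge_of_sq_deriv_ge h.period_pos (hd 0) h.hasDerivAt_length h.speed_pos
      (fun t ht => ⟨hcon t ht, h.chord 0 t ht.1 (by rw [zero_add]; exact ht.2)⟩)
      (h.sq_deriv_ge 0) with h1 | h1 <;> linarith [h1.1]
  have h1 := hreach 0 b hb.1.le (by rw [zero_add]; exact hb.2) hub
  have h2 := hreach b P hb.2.le (by linarith [hb.1]) (by
    rw [← zero_add P, h.periodic, lorentz_comm]; exact hub)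
  have h3 := h.length_add 0
  rw [zero_add] at h3
  linarith

end IsAchronalLoop

/-! ### Closed strong spacelike curves -/

/-- The tangent indicatrix of a closed strong spacelike curve of index `1` is a closed spacelike
curve with spacelike chords, and its length is the total curvature. -/
lemma isAchronalLoop_unitTangent {γ : ℝ → Space} {P : ℝ} (hP : 0 < P) (hγ : ContDiff ℝ 2 γ)
    (hper : Function.Periodic γ P) (hstrong : IsStrongSpacelike γ) (hindex : HasIndex γ P 1) :
    IsAchronalLoop (unitTangent γ) (deriv (unitTangent γ))
      (fun t => curvature γ t * speed γ t) (fun t => ∫ s in (0 : ℝ)..t, curvature γ s * speed γ s)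
      P (totalCurvature γ P) := by
  obtain ⟨hspace, hplane⟩ := hstrong
  have hv : ∀ t, 0 < speed γ t := fun t => Real.sqrt_pos.2 (hspace t)
  have hγ' : ContDiff ℝ 1 (deriv γ) := by
    rw [show (2 : WithTop ℕ∞) = 1 + 1 by norm_num, contDiff_succ_iff_deriv] at hγ
    exact hγ.2.2
  have hi : ∀ i, ContDiff ℝ 1 fun t => deriv γ t i := fun i => contDiff_pi.1 hγ' i
  have hvc : ContDiff ℝ 1 (speed γ) := by
    refine ContDiff.sqrt ?_ fun t => (hspace t).ne'
    exact (((hi 0).mul (hi 0)).add ((hi 1).mul (hi 1))).sub ((hi 2).mul (hi 2))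
  have hTc : ContDiff ℝ 1 (unitTangent γ) := (hvc.inv fun t => (hv t).ne').smul hγ'
  have hTd : ∀ t, HasDerivAt (unitTangent γ) (deriv (unitTangent γ) t) t := fun t =>
    (hTc.differentiable one_ne_zero t).hasDerivAt
  have hT'c : Continuous (deriv (unitTangent γ)) := hTc.continuous_deriv le_rfl
  have hunit : ∀ t, lorentz (unitTangent γ t) (unitTangent γ t) = 1 := fun t => by
    have h1 : speed γ t ^ 2 = lorentz (deriv γ t) (deriv γ t) := Real.sq_sqrt (hspace t).le
    have h2 := (hv t).ne'
    rw [unitTangent, lorentz_smul_left, lorentz_smul_right, ← h1]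
    field_simp
  have hKpos : ∀ t, 0 < lorentz (curvatureVector γ t) (curvatureVector γ t) := by
    intro t
    refine (hplane t).2 _ (Submodule.subset_span (by simp)) fun h0 => ?_
    have h1 := (hplane t).1
    rw [h0, Set.pair_comm, Submodule.span_insert_zero] at h1
    have h2 := finrank_span_le_card (R := ℝ) ({unitTangent γ t} : Set Space)
    rw [h1, Set.toFinset_singleton, Finset.card_singleton] at h2
    omega
  have hκ : ∀ t, curvature γ t * speed γ t
      = √(lorentz (deriv (unitTangent γ) t) (deriv (unitTangent γ) t)) := fun t => by
    have h2 := (hv t).ne'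
    rw [curvature, curvatureVector, lorentz_smul_left, lorentz_smul_right, ← mul_assoc,
      Real.sqrt_mul (by positivity [hv t]), Real.sqrt_mul_self (inv_pos.2 (hv t)).le]
    field_simp
  have hpos : ∀ t, 0 < curvature γ t * speed γ t := fun t =>
    mul_pos (Real.sqrt_pos.2 (hKpos t)) (hv t)
  have hT'pos : ∀ t, 0 < lorentz (deriv (unitTangent γ) t) (deriv (unitTangent γ) t) :=
    fun t => Real.sqrt_pos.1 (hκ t ▸ hpos t)
  have hcont : Continuous fun t => curvature γ t * speed γ t := by
    simp only [hκ, lorentz]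
    fun_prop
  have hγ'P : Function.Periodic (deriv γ) P := fun t => by
    rw [← deriv_comp_add_const, funext hper]
  have hTP : Function.Periodic (unitTangent γ) P := fun t => by
    simp only [unitTangent, speed, hγ'P t]
  have hT'P : Function.Periodic (deriv (unitTangent γ)) P := fun t => by
    rw [← deriv_comp_add_const, funext hTP]
  have hσP : Function.Periodic (fun t => curvature γ t * speed γ t) P := fun t => by
    simp only [hκ, hT'P t]
  refine ⟨hP, hTd, hunit, hpos, fun t => ?_, fun t => ?_, hTP, fun t => ?_, fun a b hab hbP => ?_⟩
  · rw [hκ, Real.sq_sqrt (hT'pos t).le]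
  · exact hcont.integral_hasStrictDerivAt 0 t |>.hasDerivAt
  · have h1 := intervalIntegral.integral_add_adjacent_intervals
      (hcont.intervalIntegrable (μ := MeasureTheory.volume) 0 t)
      (hcont.intervalIntegrable t (t + P))
    have h2 := hσP.intervalIntegral_add_eq t 0
    rw [zero_add] at h2
    simp only [totalCurvature]
    rw [← h1, h2]
  · rcases hindex with hw | hw
    · exact lorentz_lt_one_of_hasWinding hP hTd hT'pos hTP hw (Or.inl rfl) hab hbP
    · exact lorentz_lt_one_of_hasWinding hP hTd hT'pos hTP hw (Or.inr rfl) hab hbP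

end Minkowski3

theorem theorem1p1 (γ : ℝ → Minkowski3.Space) (P : ℝ) (hP : 0 < P)
    (hγ : ContDiff ℝ 2 γ) (hper : Function.Periodic γ P)
    (hstrong : Minkowski3.IsStrongSpacelike γ) (hindex : Minkowski3.HasIndex γ P 1) :
    Minkowski3.totalCurvature γ P ≤ 2 * Real.pi ∧
      (Minkowski3.totalCurvature γ P = 2 * Real.pi ↔
        ∃ E : AffineSubspace ℝ Minkowski3.Space,
          Minkowski3.IsSpacelikePlane E.direction ∧ Minkowski3.IsConvexCurveIn E γ P) := by
  have hloop := Minkowski3.isAchronalLoop_unitTangent hP hγ hper hstrong hindex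
  have hv : ∀ t, 0 < Minkowski3.speed γ t := fun t => Real.sqrt_pos.2 (hstrong.1 t)
  have hγd : ∀ t, HasDerivAt γ (deriv γ t) t := fun t =>
    (hγ.differentiable two_ne_zero t).hasDerivAt
  have hγT : ∀ t, HasDerivAt γ (Minkowski3.speed γ t • Minkowski3.unitTangent γ t) t := by
    intro t
    rw [Minkowski3.unitTangent, smul_inv_smul₀ (hv t).ne']
    exact hγd t
  have hplane : ∀ t, Minkowski3.IsSpacelikePlane (Submodule.span ℝ
      {Minkowski3.unitTangent γ t, deriv (Minkowski3.unitTangent γ) t}) := by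
    intro t
    have h1 := hstrong.2 t
    rwa [Minkowski3.curvatureVector, Submodule.span_insert, Submodule.span_singleton_smul_eq
      (inv_ne_zero (hv t).ne').isUnit, ← Submodule.span_insert] at h1
  have hle := hloop.length_le_two_pi hv hγT hper
  refine ⟨hle, fun hL => hloop.exists_isConvexCurveIn hv hγT hper hplane hL, ?_⟩
  rintro ⟨E, hE, hmem, -, -⟩
  refine le_antisymm hle (hloop.two_pi_le_length hE fun t => E.direction.smul_mem _ ?_)
  exact Minkowski3.mem_of_hasDerivAt (hγd t) fun s =>
    AffineSubspace.vsub_mem_direction (hmem s) (hmem t)
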